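/- For a finite graph $H$, let $\mathrm{v}(H)$ and $\mathrm{e}(H)$ be its numbers of vertices and edges. A bipartite graph $H$ is called $(\alpha,C,\beta)$-Erdős–Simonovits good if for every $n$, every graph $G$ on $n$ vertices with $\mathrm{e}(G)=pn^2\ge Cn^{1+\alpha}$ contains at least $\beta\,p^{\mathrm{e}(H)}n^{\mathrm{v}(H)}$ copies of $H$ (subgraphs of $G$ isomorphic to $H$). Let $T$ be a tree on $t\ge 3$ vertices with $r$ leaves (vertices of degree one), and let $s\ge 1$. Let $T^s$ be the graph obtained from $s$ disjoint copies of $T$ by identifying, for each leaf $\ell$ of $T$, the $s$ copies of $\ell$ to a single vertex. Then there exist constants $C>0$ and $\beta>0$, depending only on $T$ and $s$, such that $T^s$ is $\left(1-\frac1r,\,C,\,\beta\right)$-Erdős–Simonovits good. Moreover $1-\frac1r\le 1-\frac1{\mathrm{e}(T)}$, and the inequality is strict unless $T$ is a star. -/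

import Mathlib

namespace ErdosSimonovits

/-- `H` is `(α, C, β)`-good: `H` is bipartite and every `n`-vertex graph `G` whose number of edges,
written as `p * n ^ 2` (that is, `p = e(G) / n ^ 2`), is at least `C * n ^ (1 + α)` contains at least
`β * p ^ e(H) * n ^ v(H)` copies of `H`. Copies are unlabelled (subgraphs of `G` isomorphic to `H`);
there are at least as many labelled ones. -/
def IsGood {W : Type*} [Finite W] (H : SimpleGraph W) (α C β : ℝ) : Prop :=
  H.IsBipartite ∧
    ∀ (n : ℕ) (G : SimpleGraph (Fin n)) (p : ℝ),
      (G.edgeSet.ncard : ℝ) = p * (n : ℝ) ^ 2 →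
      C * (n : ℝ) ^ (1 + α) ≤ p * (n : ℝ) ^ 2 →
      β * p ^ H.edgeSet.ncard * (n : ℝ) ^ Nat.card W ≤ (G.copyCount H : ℝ)

/-- The leaves of a graph: the vertices with exactly one neighbour. -/
def leaves {V : Type*} (T : SimpleGraph V) : Set V :=
  {v | (T.neighborSet v).ncard = 1}

/-- Vertex set of the graph glued from `s` copies of a graph on `V` along the vertex set `S`:
one copy of each vertex of `S`, and `s` copies of each vertex outside `S`. -/
abbrev GlueVertex {V : Type*} (S : Set V) (s : ℕ) : Type _ :=
  ↥S ⊕ (↥Sᶜ × Fin s)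

open Classical in
/-- The position of the `i`-th copy in the glued vertex set. -/
noncomputable def glueEmb {V : Type*} (S : Set V) (s : ℕ) (i : Fin s) : V ↪ GlueVertex S s where
  toFun v := if h : v ∈ S then Sum.inl ⟨v, h⟩ else Sum.inr (⟨v, h⟩, i)
  inj' u v huv := by
    by_cases hu : u ∈ S <;> by_cases hv : v ∈ S <;> simp_all

/-- The graph obtained from `s` copies of `H` by gluing them along the (labelled) vertex set `S`:
the union of the `s` copies. -/
noncomputable def glue {V : Type*} (H : SimpleGraph V) (S : Set V) (s : ℕ) :
    SimpleGraph (GlueVertex S s) :=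
  ⨆ i : Fin s, H.map (glueEmb S s i)

end ErdosSimonovits

namespace ErdosSimonovits

open Finset

/-! Write t = |V|, let S be the glued set and r = |S|. Trimming `G` leaves a graph with minimum
degree at least d = pn/2 and degree sum D between pn² and 2pn². Weigh the homomorphisms X of the
tree by the random walk indexed by it: the root is placed with weight its degree, and each child at
a uniform neighbour of its parent. The walk is reversible, so the weight does not depend on the
root. Its total is D (`sum_treeWeight`), a single X weighs at most d^(-(t-2)) (`treeWeight_le`), and
injective maps carry at least 3D/4.

Group the injective maps by their restriction L to S. Let q(L) be the product of the degrees along L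
and μ(L) the weight of the extensions of L. As the q(L) sum to D^r, those L with q(L) > 4 D^(r-1)
μ(L) carry at most D/4, and the other, rich L at least D/2 (`half_le_sum_sum_extensions`). Rooting
in S, the extensions of L with one more prescribed value weigh at most q(L) d^(-(2r-1)). For rich L
this is a fraction O(1/(n p^r)) of μ(L), small once p ≥ C n^(-1/r): hence the exponent 1 - 1/r. A
greedy choice then yields many s-tuples of extensions disjoint off S (`pow_le_card_families`), and
the power mean inequality over the at most n^r rich L gives the count. -/

/-! ### Summation along rooted trees -/

open scoped Classical in
theorem sum_sum_update {V A : Type*} [Fintype V] [Fintype A] (w : V) (f : (V → A) → ℝ) :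
    ∑ X : V → A, ∑ y : A, f (Function.update X w y) = Fintype.card A * ∑ X : V → A, f X := by
  -- Exchanging the value at `w` with `y` is an involution of the pairs `(X, y)`.
  have hinv : Function.Involutive
      (fun q : (V → A) × A => (Function.update q.1 w q.2, q.1 w)) := by
    rintro ⟨X, y⟩
    simp
  rw [← Fintype.sum_prod_type' (fun (X : V → A) (y : A) => f (Function.update X w y)),
    ← Equiv.sum_comp hinv.toPerm]
  simp only [Function.Involutive.coe_toPerm, Function.update_idem, Function.update_eq_self]
  rw [Fintype.sum_prod_type]
  simp [Finset.mul_sum]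

open scoped Classical in
/-- Summing a product of transition kernels along a rooted tree, one leaf at a time. -/
theorem sum_prod_kernel_aux {V A : Type*} [Fintype V] [Fintype A] [Nonempty A]
    (rank : V → ℕ) (ρ : V) (par : V → V) (hpar : ∀ w, w ≠ ρ → rank (par w) < rank w)
    (k : V → A → A → ℝ) (hk : ∀ w u y, 0 ≤ k w u y) (a b : V → ℝ) (ha : ∀ w, 0 ≤ a w)
    (hab : ∀ w u, a w ≤ ∑ y, k w u y ∧ ∑ y, k w u y ≤ b w) (h : A → ℝ) (hh : ∀ x, 0 ≤ h x)
    (S : Finset V) (hS : ρ ∉ S) :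
    (∑ X : V → A, h (X ρ)) * ∏ w ∈ S, a w ≤
        (Fintype.card A : ℝ) ^ #S * ∑ X : V → A, h (X ρ) * ∏ w ∈ S, k w (X (par w)) (X w) ∧
      (Fintype.card A : ℝ) ^ #S * ∑ X : V → A, h (X ρ) * ∏ w ∈ S, k w (X (par w)) (X w) ≤
        (∑ X : V → A, h (X ρ)) * ∏ w ∈ S, b w := by
  have hb : ∀ w, 0 ≤ b w := fun w =>
    (ha w).trans ((hab w (Classical.arbitrary A)).1.trans (hab w (Classical.arbitrary A)).2)
  -- The vertex added last has maximal rank, so it is the parent of no vertex of `S`: its value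
  -- enters only its own kernel and can be summed out.
  induction S using Finset.induction_on_max_value rank with
  | empty => simp
  | insert w S hw hmax ih =>
    have hρ : ρ ≠ w := fun e => hS (by simp [e])
    obtain ⟨ih₁, ih₂⟩ := ih (fun e => hS (by simp [e]))
    have key : (Fintype.card A : ℝ) * ∑ X : V → A, h (X ρ) *
          ∏ v ∈ insert w S, k v (X (par v)) (X v) =
        ∑ X : V → A, (h (X ρ) * ∏ v ∈ S, k v (X (par v)) (X v)) * ∑ y, k w (X (par w)) y := by
      rw [← sum_sum_update w]
      refine Finset.sum_congr rfl fun X _ => ?_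
      rw [Finset.mul_sum]
      refine Finset.sum_congr rfl fun y _ => ?_
      rw [Finset.prod_insert hw, Function.update_of_ne hρ, Function.update_self,
        Function.update_of_ne (fun e => by have := hpar w hρ.symm; rw [e] at this; omega)]
      rw [mul_comm (k w _ _), ← mul_assoc]
      congr 2
      refine Finset.prod_congr rfl fun v hv => ?_
      have hvw : v ≠ w := fun e => hw (e ▸ hv)
      have hvρ : v ≠ ρ := fun e => hS (by simp [← e, hv])
      rw [Function.update_of_ne hvw, Function.update_of_ne
        (fun e => by have h1 := hpar v hvρ; have h2 := hmax v hv; rw [e] at h1; omega)]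
    have hnn : ∀ X : V → A, 0 ≤ h (X ρ) * ∏ v ∈ S, k v (X (par v)) (X v) := fun X =>
      mul_nonneg (hh _) (Finset.prod_nonneg fun v _ => hk _ _ _)
    rw [Finset.card_insert_of_notMem hw, pow_succ, mul_assoc, key, Finset.prod_insert hw,
      Finset.prod_insert hw]
    constructor
    · calc _ = ((∑ X : V → A, h (X ρ)) * ∏ w ∈ S, a w) * a w := by ring
        _ ≤ _ := mul_le_mul_of_nonneg_right ih₁ (ha w)
        _ = (Fintype.card A : ℝ) ^ #S * ∑ X : V → A,
              (h (X ρ) * ∏ v ∈ S, k v (X (par v)) (X v)) * a w := by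
            rw [← Finset.sum_mul]; ring
        _ ≤ _ := by
            gcongr with X _
            · exact hnn X
            · exact (hab w _).1
    · calc _ ≤ (Fintype.card A : ℝ) ^ #S * ∑ X : V → A,
              (h (X ρ) * ∏ v ∈ S, k v (X (par v)) (X v)) * b w := by
            gcongr with X _
            · exact hnn X
            · exact (hab w _).2
        _ = ((Fintype.card A : ℝ) ^ #S * ∑ X : V → A,
              (h (X ρ) * ∏ v ∈ S, k v (X (par v)) (X v))) * b w := by
            rw [← Finset.sum_mul]; ring
        _ ≤ _ := mul_le_mul_of_nonneg_right ih₂ (hb w)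
        _ = _ := by ring

open scoped Classical in
theorem sum_apply_eq {V A : Type*} [Fintype V] [Fintype A] (ρ : V) (h : A → ℝ) :
    ∑ X : V → A, h (X ρ) = (Fintype.card A : ℝ) ^ #(univ.erase ρ) * ∑ x, h x := by
  rw [← (Equiv.funSplitAt ρ A).symm.sum_comp, Fintype.sum_prod_type]
  simp [Finset.mul_sum, Fintype.card_subtype_compl]

-- The bounds are two-sided because `a = b = 1` gives an exact total, while `a = 0` serves when only
-- an upper bound is wanted.
open scoped Classical in
theorem sum_prod_kernel {V A : Type*} [Fintype V] [Fintype A] [Nonempty A]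
    (rank : V → ℕ) (ρ : V) (par : V → V) (hpar : ∀ w, w ≠ ρ → rank (par w) < rank w)
    (k : V → A → A → ℝ) (hk : ∀ w u y, 0 ≤ k w u y) (a b : V → ℝ) (ha : ∀ w, 0 ≤ a w)
    (hab : ∀ w u, a w ≤ ∑ y, k w u y ∧ ∑ y, k w u y ≤ b w) (h : A → ℝ) (hh : ∀ x, 0 ≤ h x) :
    (∑ x, h x) * ∏ w ∈ univ.erase ρ, a w ≤
        ∑ X : V → A, h (X ρ) * ∏ w ∈ univ.erase ρ, k w (X (par w)) (X w) ∧
      ∑ X : V → A, h (X ρ) * ∏ w ∈ univ.erase ρ, k w (X (par w)) (X w) ≤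
        (∑ x, h x) * ∏ w ∈ univ.erase ρ, b w := by
  have H := sum_prod_kernel_aux rank ρ par hpar k hk a b ha hab h hh (univ.erase ρ) (by simp)
  have hpos : (0 : ℝ) < (Fintype.card A : ℝ) ^ #((univ : Finset V).erase ρ) := by
    have : 0 < Fintype.card A := Fintype.card_pos
    positivity
  rw [sum_apply_eq, mul_assoc, mul_assoc] at H
  exact ⟨le_of_mul_le_mul_left H.1 hpos, le_of_mul_le_mul_left H.2 hpos⟩

theorem exists_adj_dist_lt {V : Type*} {T : SimpleGraph V} (hT : T.Connected) {ρ w : V}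
    (h : w ≠ ρ) : ∃ u, T.Adj u w ∧ T.dist ρ u < T.dist ρ w := by
  obtain ⟨p, hp⟩ := hT.exists_walk_length_eq_dist w ρ
  cases p with
  | nil => exact absurd rfl h
  | @cons _ u _ hadj q =>
    refine ⟨u, hadj.symm, ?_⟩
    rw [SimpleGraph.dist_comm, SimpleGraph.dist_comm (u := ρ) (v := w), ← hp]
    have := SimpleGraph.dist_le q
    simp only [SimpleGraph.Walk.length_cons]
    omega

open scoped Classical in
/-- A rooted finite tree: each vertex other than the root has a parent, and the edges of the tree
are exactly the parent edges. -/
theorem exists_parent {V : Type*} [Fintype V] {T : SimpleGraph V} (hT : T.IsTree) (ρ : V) :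
    ∃ par : V → V, (∀ w, w ≠ ρ → T.dist ρ (par w) < T.dist ρ w) ∧
      (∀ w, w ≠ ρ → T.Adj (par w) w) ∧
      ∀ f : Sym2 V → ℝ, ∏ e ∈ T.edgeFinset, f e = ∏ w ∈ univ.erase ρ, f s(par w, w) := by
  have H : ∀ w, ∃ u, w ≠ ρ → T.Adj u w ∧ T.dist ρ u < T.dist ρ w := by
    intro w
    by_cases h : w = ρ
    · exact ⟨w, fun h' => absurd h h'⟩
    · obtain ⟨u, hu⟩ := exists_adj_dist_lt hT.connected h
      exact ⟨u, fun _ => hu⟩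
  choose par hpar using H
  refine ⟨par, fun w hw => (hpar w hw).2, fun w hw => (hpar w hw).1, fun f => ?_⟩
  -- Two vertices that are each other's parent would each be strictly closer to the root than the
  -- other.
  have hinj : Set.InjOn (fun w => s(par w, w)) (univ.erase ρ : Finset V) := by
    intro w hw v hv hwv
    have hw' : w ≠ ρ := by simpa using hw
    have hv' : v ≠ ρ := by simpa using hv
    have h1 := (hpar w hw').2
    have h2 := (hpar v hv').2
    simp only [Sym2.eq_iff] at hwv
    rcases hwv with h | h
    · exact h.2
    · rw [h.1] at h1
      rw [← h.2] at h2
      omega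
  have himg : (univ.erase ρ).image (fun w => s(par w, w)) = T.edgeFinset := by
    apply Finset.eq_of_subset_of_card_le
    · intro e he
      obtain ⟨w, hw, rfl⟩ := Finset.mem_image.1 he
      simpa using (hpar w (by simpa using hw)).1
    · rw [Finset.card_image_of_injOn hinj, Finset.card_erase_of_mem (mem_univ _)]
      have := hT.card_edgeFinset
      simp only [Finset.card_univ]
      omega
  rw [← himg, Finset.prod_image hinj]


theorem sum_filter_le_sum_sum_filter {ι α : Type*} (I : Finset ι) (s : Finset α) {f : α → ℝ}
    (hf : ∀ x, 0 ≤ f x) (P : α → Prop) [DecidablePred P] (p : ι → α → Prop)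
    [∀ i, DecidablePred (p i)] (hP : ∀ x, P x → ∃ i ∈ I, p i x) :
    ∑ x ∈ s with P x, f x ≤ ∑ i ∈ I, ∑ x ∈ s with p i x, f x := by
  simp only [Finset.sum_filter]
  rw [Finset.sum_comm]
  refine Finset.sum_le_sum fun x _ => ?_
  split_ifs with h
  · obtain ⟨i, hi, hp⟩ := hP x h
    refine le_trans (le_of_eq (if_pos hp).symm) (Finset.single_le_sum (f := fun i =>
      if p i x then f x else 0) (fun j _ => ?_) hi)
    split_ifs
    exacts [hf x, le_rfl]
  · refine Finset.sum_nonneg fun j _ => ?_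
    split_ifs
    exacts [hf x, le_rfl]

/-! ### The tree-indexed random walk -/

section TreeWeight

open scoped Classical

variable {V A : Type*} [Fintype V] [Fintype A]

/-- The weight of an edge: inverse product of the degrees of its ends, and zero on non-edges. -/
noncomputable def edgeWeight (G : SimpleGraph A) : Sym2 A → ℝ :=
  Sym2.lift ⟨fun x y => if G.Adj x y then ((G.degree x : ℝ) * G.degree y)⁻¹ else 0, fun x y => by
    simp only [G.adj_comm x y, mul_comm]⟩

/-- The weight of a map from a tree to a graph. It vanishes unless the map is a homomorphism; up to
normalisation it is the probability of the map under the random walk indexed by the tree. -/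
noncomputable def treeWeight (T : SimpleGraph V) (G : SimpleGraph A) (X : V → A) : ℝ :=
  (∏ w, (G.degree (X w) : ℝ)) * ∏ e ∈ T.edgeFinset, edgeWeight G (e.map X)

theorem edgeWeight_nonneg (G : SimpleGraph A) (e : Sym2 A) : 0 ≤ edgeWeight G e := by
  induction e using Sym2.ind with
  | _ x y =>
    simp only [edgeWeight, Sym2.lift_mk]
    split_ifs <;> positivity

theorem treeWeight_nonneg (T : SimpleGraph V) (G : SimpleGraph A) (X : V → A) :
    0 ≤ treeWeight T G X :=
  mul_nonneg (Finset.prod_nonneg fun _ _ => by positivity)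
    (Finset.prod_nonneg fun _ _ => edgeWeight_nonneg _ _)

theorem adj_of_treeWeight_ne_zero {T : SimpleGraph V} {G : SimpleGraph A} {X : V → A}
    (h : treeWeight T G X ≠ 0) {u v : V} (huv : T.Adj u v) : G.Adj (X u) (X v) := by
  have h1 := right_ne_zero_of_mul h
  rw [Finset.prod_ne_zero_iff] at h1
  have h2 := h1 s(u, v) (by simpa using huv)
  by_contra hn
  apply h2
  simp [edgeWeight, hn]

/-- The degree at each non-root vertex cancels against its parent edge, leaving a transition
probability. The definition is symmetric, so any root may be chosen. -/
theorem treeWeight_eq_rooted {T : SimpleGraph V} {G : SimpleGraph A} (hG : ∀ x, 0 < G.degree x)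
    {ρ : V} {par : V → V}
    (hprod : ∀ f : Sym2 V → ℝ, ∏ e ∈ T.edgeFinset, f e = ∏ w ∈ univ.erase ρ, f s(par w, w))
    (X : V → A) :
    treeWeight T G X = G.degree (X ρ) * ∏ w ∈ univ.erase ρ,
      if G.Adj (X (par w)) (X w) then ((G.degree (X (par w)) : ℝ))⁻¹ else 0 := by
  rw [treeWeight, hprod, ← Finset.mul_prod_erase univ _ (mem_univ ρ), mul_assoc,
    ← Finset.prod_mul_distrib]
  congr 1
  refine Finset.prod_congr rfl fun w _ => ?_
  have h := hG (X w)
  simp only [edgeWeight, Sym2.map_mk, Sym2.lift_mk]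
  split_ifs
  · field_simp
  · simp

theorem sum_kernel_eq_one {G : SimpleGraph A} (hG : ∀ x, 0 < G.degree x) (u : A) :
    ∑ y, (if G.Adj u y then ((G.degree u : ℝ))⁻¹ else 0) = 1 := by
  have h := hG u
  rw [← Finset.sum_filter, Finset.sum_const, ← G.neighborFinset_eq_filter,
    G.card_neighborFinset_eq_degree]
  simp [h.ne']

theorem sum_treeWeight [Nonempty A] {T : SimpleGraph V} (hT : T.IsTree) {G : SimpleGraph A}
    (hG : ∀ x, 0 < G.degree x) : ∑ X, treeWeight T G X = ∑ x, (G.degree x : ℝ) := by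
  obtain ⟨ρ⟩ := hT.connected.nonempty
  obtain ⟨par, hlt, -, hprod⟩ := exists_parent hT ρ
  have H := sum_prod_kernel (A := A) (T.dist ρ) ρ par hlt
    (fun _ u y => if G.Adj u y then ((G.degree u : ℝ))⁻¹ else 0)
    (fun _ _ _ => by split_ifs <;> positivity) (fun _ => 1) (fun _ => 1) (fun _ => zero_le_one)
    (fun _ u => by rw [sum_kernel_eq_one hG]; exact ⟨le_rfl, le_rfl⟩)
    (fun x => (G.degree x : ℝ)) (fun _ => by positivity)
  simp only [Finset.prod_const_one, mul_one] at H
  simp only [treeWeight_eq_rooted hG hprod]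
  exact le_antisymm H.2 H.1

/-- The weight of all maps with prescribed values at the root and on a set `B`. -/
theorem sum_treeWeight_prescribed_le [Nonempty A] {T : SimpleGraph V} (hT : T.IsTree)
    {G : SimpleGraph A} {d : ℝ} (hd : 0 < d) (hG : ∀ x, d ≤ G.degree x) (ρ : V) (B : Finset V)
    (hB : ρ ∉ B) (x : A) (τ : V → A) :
    ∑ X with X ρ = x ∧ ∀ w ∈ B, X w = τ w, treeWeight T G X ≤ G.degree x * (d⁻¹) ^ #B := by
  have hG' : ∀ x, 0 < G.degree x := fun x => by exact_mod_cast hd.trans_le (hG x)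
  obtain ⟨par, hlt, -, hprod⟩ := exists_parent hT ρ
  -- At a vertex of `B` the walk must hit one given value, which has probability at most `d⁻¹`;
  -- elsewhere it is free and contributes 1.
  have H := sum_prod_kernel (A := A) (T.dist ρ) ρ par hlt
    (fun w u y => if w ∈ B → y = τ w then
      (if G.Adj u y then ((G.degree u : ℝ))⁻¹ else 0) else 0)
    (fun _ _ _ => by split_ifs <;> positivity) (fun _ => 0)
    (fun w => if w ∈ B then d⁻¹ else 1) (fun _ => le_rfl)
    (fun w u => ?_) (fun z => if z = x then (G.degree x : ℝ) else 0)
    (fun _ => by split_ifs <;> positivity)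
  · refine le_trans (le_of_eq ?_) (H.2.trans (le_of_eq ?_))
    · rw [Finset.sum_filter]
      refine Finset.sum_congr rfl fun X _ => ?_
      rw [treeWeight_eq_rooted hG' hprod]
      by_cases hx : X ρ = x
      · by_cases hX : ∀ w ∈ B, X w = τ w
        · rw [if_pos ⟨hx, hX⟩, if_pos hx, hx]
          congr 1
          exact Finset.prod_congr rfl fun w _ => by rw [if_pos (hX w)]
        · rw [if_neg (fun h => hX h.2)]
          push Not at hX
          obtain ⟨w, hw, hne⟩ := hX
          rw [Finset.prod_eq_zero (i := w), mul_zero]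
          · simp only [mem_erase, mem_univ, and_true]
            rintro rfl
            exact hB hw
          · rw [if_neg]
            exact fun h => hne (h hw)
      · rw [if_neg (fun h => hx h.1), if_neg hx, zero_mul]
    · simp only [Finset.sum_ite_eq', mem_univ, if_true]
      congr 1
      rw [Finset.prod_ite]
      have : (univ.erase ρ).filter (· ∈ B) = B := by
        ext w
        simp only [mem_filter, mem_erase, mem_univ, and_true, and_iff_right_iff_imp]
        rintro hw rfl
        exact hB hw
      simp [this]
  · refine ⟨Finset.sum_nonneg fun _ _ => by split_ifs <;> positivity, ?_⟩
    by_cases hw : w ∈ B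
    · simp only [hw, true_imp_iff, if_true, Finset.sum_ite_eq', mem_univ]
      split_ifs
      · exact inv_anti₀ hd (hG u)
      · positivity
    · simp only [hw, false_imp_iff, if_true, if_false]
      exact (sum_kernel_eq_one hG' u).le

/-- The degree at the root cancels the transition to one child; each of the other `card V - 2`
transitions is at most `d⁻¹`. -/
theorem treeWeight_le {T : SimpleGraph V} (hT : T.IsTree) (hV : 2 ≤ Fintype.card V)
    {G : SimpleGraph A} {d : ℝ} (hd : 0 < d) (hG : ∀ x, d ≤ G.degree x) (X : V → A) :
    treeWeight T G X ≤ (d⁻¹) ^ (Fintype.card V - 2) := by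
  have hG' : ∀ x, 0 < G.degree x := fun x => by exact_mod_cast hd.trans_le (hG x)
  obtain ⟨ρ⟩ := hT.connected.nonempty
  obtain ⟨par, hlt, hadj, hprod⟩ := exists_parent hT ρ
  have : Nontrivial V := Fintype.one_lt_card_iff_nontrivial.1 hV
  obtain ⟨v, hv⟩ := hT.connected.preconnected.exists_adj_of_nontrivial ρ
  obtain ⟨c, hc, hpc⟩ : ∃ c, c ≠ ρ ∧ par c = ρ := by
    refine ⟨v, hv.ne', ?_⟩
    have h1 := hlt v hv.ne'
    rw [SimpleGraph.dist_eq_one_iff_adj.2 hv] at h1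
    exact ((hT.connected.dist_eq_zero_iff).1 (by omega)).symm
  rw [treeWeight_eq_rooted hG' hprod, ← Finset.mul_prod_erase _ _
    (show c ∈ univ.erase ρ by simp [hc]), hpc, ← mul_assoc]
  have hle : ∀ u y, (if G.Adj u y then ((G.degree u : ℝ))⁻¹ else 0) ≤ d⁻¹ := by
    intro u y
    split_ifs
    · exact inv_anti₀ hd (hG u)
    · positivity
  have hcard : #((univ.erase ρ).erase c) = Fintype.card V - 2 := by
    rw [Finset.card_erase_of_mem (by simp [hc]), Finset.card_erase_of_mem (mem_univ _),
      Finset.card_univ]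
    omega
  have h1 : (G.degree (X ρ) : ℝ) *
      (if G.Adj (X ρ) (X c) then ((G.degree (X ρ) : ℝ))⁻¹ else 0) ≤ 1 := by
    have := hG' (X ρ)
    split_ifs
    · rw [mul_inv_cancel₀ (by positivity)]
    · simp
  rw [← hcard, ← Finset.prod_const, ← one_mul (∏ _ ∈ _, d⁻¹)]
  refine mul_le_mul h1 ?_ (Finset.prod_nonneg fun _ _ => by split_ifs <;> positivity) zero_le_one
  exact Finset.prod_le_prod (fun _ _ => by split_ifs <;> positivity) fun _ _ => hle _ _

/-- Maps identifying two given vertices carry a small proportion of the weight. -/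
theorem sum_treeWeight_eq_le [Nonempty A] {T : SimpleGraph V} (hT : T.IsTree)
    {G : SimpleGraph A} {d : ℝ} (hd : 0 < d) (hG : ∀ x, d ≤ G.degree x) {a b : V} (hab : a ≠ b) :
    ∑ X with X a = X b, treeWeight T G X ≤ (∑ x, (G.degree x : ℝ)) * d⁻¹ := by
  rw [← Finset.sum_fiberwise (univ.filter fun X : V → A => X a = X b) (fun X => X a),
    Finset.sum_mul]
  refine Finset.sum_le_sum fun x _ => ?_
  have H := sum_treeWeight_prescribed_le hT hd hG a {b} (by simpa using hab) x (fun _ => x)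
  simp only [mem_singleton, forall_eq, card_singleton, pow_one] at H
  refine le_trans (le_of_eq (Finset.sum_congr ?_ fun _ _ => rfl)) H
  ext X
  simp only [mem_filter, mem_univ, true_and]
  constructor
  · rintro ⟨h1, h2⟩
    exact ⟨h2, h1 ▸ h2⟩
  · rintro ⟨h1, h2⟩
    exact ⟨h1.trans h2.symm, h1⟩

/-- The weight of the non-injective maps. -/
theorem sum_treeWeight_not_injective_le [Nonempty A] {T : SimpleGraph V} (hT : T.IsTree)
    {G : SimpleGraph A} {d : ℝ} (hd : 0 < d) (hG : ∀ x, d ≤ G.degree x) :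
    ∑ X with ¬ Function.Injective X, treeWeight T G X ≤
      (Fintype.card V : ℝ) ^ 2 * ((∑ x, (G.degree x : ℝ)) * d⁻¹) := by
  calc _ ≤ ∑ q : V × V with q.1 ≠ q.2, ∑ X : V → A with X q.1 = X q.2, treeWeight T G X := by
        refine sum_filter_le_sum_sum_filter _ _ (treeWeight_nonneg T G) _ _ fun X hX => ?_
        simp only [Function.Injective, not_forall] at hX
        obtain ⟨a, b, h, hne⟩ := hX
        exact ⟨(a, b), by simpa using hne, h⟩
    _ ≤ ∑ q : V × V with q.1 ≠ q.2, ((∑ x, (G.degree x : ℝ)) * d⁻¹) :=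
        Finset.sum_le_sum fun q hq => sum_treeWeight_eq_le hT hd hG (by simpa using hq)
    _ ≤ ∑ q : V × V, ((∑ x, (G.degree x : ℝ)) * d⁻¹) := by
        refine Finset.sum_le_sum_of_subset_of_nonneg (filter_subset _ _) fun _ _ _ => by positivity
    _ = _ := by
        rw [Finset.sum_const, Finset.card_univ, Fintype.card_prod, nsmul_eq_mul]
        push_cast
        ring

end TreeWeight


/-! ### Greedy selection -/

open scoped Classical in
/-- Greedy selection of `k` elements avoiding a relation, counted with weights. -/
theorem pow_le_sum_prod_of_sparse_relation {α : Type*} [Fintype α] (Ω : Finset α) {W : α → ℝ}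
    (hW : ∀ x, 0 ≤ W x) (R : α → α → Prop) {θ : ℝ}
    (hR : ∀ x ∈ Ω, ∑ y ∈ Ω with R x y, W y ≤ θ) (hθ : 0 ≤ θ) {s : ℕ}
    (hs : s * θ ≤ (∑ x ∈ Ω, W x) / 2) (k : ℕ) (hk : k ≤ s) :
    ((∑ x ∈ Ω, W x) / 2) ^ k ≤
      ∑ Y : Fin k → α with (∀ i, Y i ∈ Ω) ∧ ∀ i j, i < j → ¬ R (Y j) (Y i), ∏ i, W (Y i) := by
  induction k with
  | zero => simp
  | succ k ih =>
    have ih' := ih (by omega)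
    rw [Finset.sum_filter] at ih' ⊢
    rw [← (Fin.consEquiv (fun _ => α)).sum_comp, Fintype.sum_prod_type, Finset.sum_comm, pow_succ]
    have hm : 0 ≤ (∑ x ∈ Ω, W x) / 2 := by
      have := Finset.sum_nonneg fun x (_ : x ∈ Ω) => hW x
      positivity
    refine (mul_le_mul_of_nonneg_right ih' hm).trans ?_
    rw [Finset.sum_mul]
    refine Finset.sum_le_sum fun Y _ => ?_
    by_cases hY : (∀ i, Y i ∈ Ω) ∧ ∀ i j, i < j → ¬ R (Y j) (Y i)
    · rw [if_pos hY]
      have hpos : 0 ≤ ∏ i, W (Y i) := Finset.prod_nonneg fun _ _ => hW _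
      -- The new element becomes index 0, in front of the `k ≤ s` chosen ones; together these
      -- exclude weight at most `s * θ`, half of the total.
      have hbad : ∑ y ∈ Ω with ∃ j ∈ (univ : Finset (Fin k)), R (Y j) y, W y ≤
          (∑ x ∈ Ω, W x) / 2 := by
        refine (sum_filter_le_sum_sum_filter univ Ω hW _ (fun j y => R (Y j) y) fun _ h => h).trans ?_
        refine (Finset.sum_le_sum fun j _ => hR (Y j) (hY.1 j)).trans ?_
        simp only [sum_const, card_univ, Fintype.card_fin, nsmul_eq_mul]
        refine le_trans ?_ hs
        gcongr
        omega
      have hgood : (∑ x ∈ Ω, W x) / 2 ≤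
          ∑ y ∈ Ω with ¬ ∃ j ∈ (univ : Finset (Fin k)), R (Y j) y, W y := by
        have := Finset.sum_filter_add_sum_filter_not Ω
          (fun y => ∃ j ∈ (univ : Finset (Fin k)), R (Y j) y) W
        linarith
      refine (mul_le_mul_of_nonneg_left hgood hpos).trans ?_
      rw [Finset.mul_sum, ← Finset.sum_filter]
      refine le_trans (le_of_eq ?_) (Finset.sum_le_sum_of_subset_of_nonneg
        (s := Ω.filter fun y => ¬ ∃ j ∈ (univ : Finset (Fin k)), R (Y j) y) ?_
        fun _ _ _ => Finset.prod_nonneg fun _ _ => hW _)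
      · refine Finset.sum_congr rfl fun y _ => ?_
        simp [Fin.consEquiv, Fin.prod_univ_succ, mul_comm]
      · intro y hy
        simp only [mem_filter, mem_univ, true_and, not_exists] at hy ⊢
        refine ⟨Fin.cases hy.1 hY.1, ?_⟩
        intro i j hij
        induction j using Fin.cases with
        | zero => exact absurd hij (Fin.not_lt_zero _)
        | succ j =>
          induction i using Fin.cases with
          | zero => exact hy.2 j
          | succ i => exact hY.2 i j (Fin.succ_lt_succ_iff.1 hij)
    · rw [if_neg hY, zero_mul]
      refine Finset.sum_nonneg fun _ _ => ?_
      split_ifs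
      exacts [Finset.prod_nonneg fun _ _ => hW _, le_rfl]

/-! ### Assembling copies of the glued graph -/

theorem glueEmb_of_mem {V : Type*} {S : Set V} {s : ℕ} (i : Fin s) {v : V} (h : v ∈ S) :
    glueEmb S s i v = Sum.inl ⟨v, h⟩ :=
  dif_pos h

theorem glueEmb_of_notMem {V : Type*} {S : Set V} {s : ℕ} (i : Fin s) {v : V} (h : v ∉ S) :
    glueEmb S s i v = Sum.inr (⟨v, h⟩, i) :=
  dif_neg h

/-- Injective homomorphisms with a common restriction to `S` and otherwise disjoint images
assemble to a copy of the glued graph. -/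
theorem exists_copy_glue {V A : Type*} {T : SimpleGraph V} {G : SimpleGraph A} {S : Set V} {s : ℕ}
    (hs : 1 ≤ s) (L : S → A) (Y : Fin s → V → A) (hL : ∀ i, ∀ l : S, Y i l = L l)
    (hinj : ∀ i, Function.Injective (Y i)) (hhom : ∀ i u v, T.Adj u v → G.Adj (Y i u) (Y i v))
    (hdisj : ∀ i j, i < j → ∀ a b, a ∉ S → b ∉ S → Y j a ≠ Y i b) :
    ∃ f : (glue T S s).Copy G, (fun l => f (Sum.inl l)) = L ∧
      (fun i v => f (glueEmb S s i v)) = Y := by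
  have hval : ∀ i v, Sum.elim L (fun p : ↥Sᶜ × Fin s => Y p.2 p.1) (glueEmb S s i v) = Y i v := by
    intro i v
    by_cases hv : v ∈ S
    · rw [glueEmb_of_mem i hv, Sum.elim_inl, ← hL i]
    · rw [glueEmb_of_notMem i hv, Sum.elim_inr]
  refine ⟨⟨⟨Sum.elim L (fun p : ↥Sᶜ × Fin s => Y p.2 p.1), ?_⟩, ?_⟩, rfl, ?_⟩
  · intro x y hxy
    simp only [glue, SimpleGraph.iSup_adj, SimpleGraph.map_adj] at hxy
    obtain ⟨i, u, v, huv, rfl, rfl⟩ := hxy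
    rw [hval, hval]
    exact hhom i u v huv
  · rintro (l | ⟨a, i⟩) (l' | ⟨b, j⟩) h
    · have h' : L l = L l' := h
      rw [← hL ⟨0, hs⟩, ← hL ⟨0, hs⟩] at h'
      rw [Subtype.ext (hinj _ h')]
    · have h' : L l = Y j b := h
      rw [← hL j] at h'
      exact absurd (hinj _ h') (fun e => b.2 (e ▸ l.2))
    · have h' : Y i a = L l' := h
      rw [← hL i] at h'
      exact absurd (hinj _ h') (fun e => a.2 (e ▸ l'.2))
    · have h' : Y i a = Y j b := h
      rcases lt_trichotomy i j with hij | rfl | hij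
      · exact absurd h'.symm (hdisj i j hij b a b.2 a.2)
      · rw [Subtype.ext (hinj _ h')]
      · exact absurd h' (hdisj j i hij a b a.2 b.2)
  · funext i v
    exact hval i v

section Glue

open scoped Classical

variable {V A : Type*} [Fintype V] [Fintype A]

/-- The weight of all maps with prescribed values on `S` and at one further vertex. -/
theorem sum_treeWeight_prescribed_on_le [Nonempty A] {T : SimpleGraph V} (hT : T.IsTree)
    {G : SimpleGraph A} {d : ℝ} (hd : 0 < d) (hG : ∀ x, d ≤ G.degree x) {S : Set V}
    (hS : S.Nonempty) {a : V} (ha : a ∉ S) (L : S → A) (v : A) :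
    ∑ X : V → A with (∀ l : S, X l = L l) ∧ X a = v, treeWeight T G X ≤
      (∏ l, (G.degree (L l) : ℝ)) * (d⁻¹) ^ (2 * Fintype.card S - 1) := by
  obtain ⟨ρ, hρ⟩ := hS
  have hr : 0 < Fintype.card S := Fintype.card_pos_iff.2 ⟨⟨ρ, hρ⟩⟩
  have haρ : ρ ≠ a := fun e => ha (e ▸ hρ)
  have hcard : #(insert a (S.toFinset.erase ρ)) = Fintype.card S := by
    rw [Finset.card_insert_of_notMem (by simp [ha]), Finset.card_erase_of_mem (by simpa using hρ),
      Set.toFinset_card]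
    omega
  have H := sum_treeWeight_prescribed_le hT hd hG ρ (insert a (S.toFinset.erase ρ))
    (by simp [haρ]) (L ⟨ρ, hρ⟩) (fun w => if h : w ∈ S then L ⟨w, h⟩ else v)
  rw [hcard] at H
  refine le_trans (le_of_eq (Finset.sum_congr (Finset.filter_congr fun X _ => ?_)
    fun _ _ => rfl)) (H.trans ?_)
  · constructor
    · rintro ⟨h1, h2⟩
      refine ⟨h1 ⟨ρ, hρ⟩, fun w hw => ?_⟩
      simp only [mem_insert, mem_erase, Set.mem_toFinset] at hw
      rcases hw with rfl | ⟨-, hw⟩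
      · rw [dif_neg ha, h2]
      · rw [dif_pos hw]
        exact h1 ⟨w, hw⟩
    · rintro ⟨h1, h2⟩
      refine ⟨?_, by simpa [ha] using h2 a (by simp)⟩
      rintro ⟨l, hl⟩
      by_cases hlρ : l = ρ
      · subst hlρ
        exact h1
      · simpa [hl] using h2 l (by simp [hl, hlρ])
  -- Rooting at `ρ ∈ S` gives `deg (L ρ) * d⁻¹ ^ card S`. Inserting the factors `deg (L l) / d ≥ 1`
  -- for the other `l` makes this symmetric in `S` and raises the exponent to `2 * card S - 1`.
  · have hprod : d ^ (Fintype.card S - 1) ≤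
        ∏ l ∈ univ.erase (⟨ρ, hρ⟩ : S), (G.degree (L l) : ℝ) := by
      rw [← Finset.card_univ, ← Finset.card_erase_of_mem (mem_univ (⟨ρ, hρ⟩ : S)),
        ← Finset.prod_const]
      exact Finset.prod_le_prod (fun _ _ => hd.le) fun _ _ => hG _
    rw [← Finset.mul_prod_erase univ _ (mem_univ (⟨ρ, hρ⟩ : S)),
      show 2 * Fintype.card S - 1 = (Fintype.card S - 1) + Fintype.card S by omega, pow_add,
      mul_assoc]
    gcongr
    rw [← mul_assoc]
    refine le_mul_of_one_le_left (by positivity) ?_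
    rw [inv_pow, ← div_eq_mul_inv, one_le_div (by positivity)]
    exact hprod

/-- The number of families of injective homomorphisms that assemble to copies of the glued graph. -/
theorem sum_card_le_labelledCopyCount {T : SimpleGraph V} {G : SimpleGraph A} {S : Set V} {s : ℕ}
    (hs : 1 ≤ s) (I : Finset (S → A)) (N : (S → A) → Finset (Fin s → V → A))
    (hL : ∀ L, ∀ Y ∈ N L, ∀ i, ∀ l : S, Y i l = L l)
    (hinj : ∀ L, ∀ Y ∈ N L, ∀ i, Function.Injective (Y i))
    (hhom : ∀ L, ∀ Y ∈ N L, ∀ i u v, T.Adj u v → G.Adj (Y i u) (Y i v))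
    (hdisj : ∀ L, ∀ Y ∈ N L, ∀ i j, i < j → ∀ a b, a ∉ S → b ∉ S → Y j a ≠ Y i b) :
    ∑ L ∈ I, #(N L) ≤ G.labelledCopyCount (glue T S s) := by
  suffices h : ∀ _ : Fintype ((glue T S s).Copy G),
      #(I.sigma N) ≤ Fintype.card ((glue T S s).Copy G) by
    rw [← Finset.card_sigma]
    exact h _
  intro _
  rw [← Finset.card_univ]
  refine le_trans (Finset.card_le_card (t := univ.image fun f : (glue T S s).Copy G =>
    (⟨fun l => f (Sum.inl l), fun i v => f (glueEmb S s i v)⟩ :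
      Σ _ : S → A, Fin s → V → A)) ?_) Finset.card_image_le
  rintro ⟨L, Y⟩ hLY
  rw [Finset.mem_sigma] at hLY
  obtain ⟨f, h1, h2⟩ := exists_copy_glue hs L Y (hL L Y hLY.2) (hinj L Y hLY.2) (hhom L Y hLY.2)
    (hdisj L Y hLY.2)
  simp only [mem_image, mem_univ, true_and]
  exact ⟨f, by rw [h1, h2]⟩

end Glue


/-! ### Supersaturation at large minimum degree -/

theorem pow_sum_le_sum_mul {ι : Type*} (I : Finset ι) {x n : ι → ℝ} (hx : ∀ i, 0 ≤ x i) {s : ℕ}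
    (hs : 1 ≤ s) (hn : ∀ i ∈ I, x i ^ s ≤ n i) {m N : ℝ} (hm : ∑ i ∈ I, n i ≤ m) (hN : #I ≤ N) :
    (∑ i ∈ I, x i) ^ s ≤ m * N ^ (s - 1) := by
  obtain ⟨s, rfl⟩ : ∃ k, s = k + 1 := ⟨_, (Nat.succ_pred_eq_of_pos hs).symm⟩
  refine (pow_sum_le_card_mul_sum_pow (fun i _ => hx i) s).trans ?_
  have h0 : 0 ≤ ∑ i ∈ I, x i ^ (s + 1) := Finset.sum_nonneg fun i _ => pow_nonneg (hx i) _
  have h1 := Finset.sum_le_sum hn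
  rw [mul_comm, Nat.add_sub_cancel]
  exact mul_le_mul (h1.trans hm) (pow_le_pow_left₀ (Nat.cast_nonneg _) hN s) (by positivity)
    (h0.trans (h1.trans hm))

/-- Two maps share a value off `S`. -/
def Meet {V A : Type*} (S : Set V) (X Y : V → A) : Prop :=
  ∃ a b, a ∉ S ∧ b ∉ S ∧ X a = Y b

section Supersaturation

open scoped Classical

variable {V A : Type*} [Fintype V] [Fintype A]

/-- The injective maps with prescribed restriction to `S`. -/
noncomputable def extensions (S : Set V) (L : S → A) : Finset (V → A) :=
  univ.filter fun X => Function.Injective X ∧ ∀ l : S, X l = L l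

theorem sum_sum_extensions (S : Set V) (f : (V → A) → ℝ) :
    ∑ L : S → A, ∑ X ∈ extensions S L, f X = ∑ X with Function.Injective X, f X := by
  rw [← Finset.sum_fiberwise (univ.filter fun X : V → A => Function.Injective X)
    (fun X (l : S) => X l)]
  refine Finset.sum_congr rfl fun L _ => Finset.sum_congr ?_ fun _ _ => rfl
  ext X
  simp [extensions, funext_iff]

/-- If the total weight of the extensions of `L` is a fair share, then there are many families of
`s` extensions that are disjoint off `S`. -/
theorem pow_le_card_families [Nonempty A] {T : SimpleGraph V} (hT : T.IsTree)
    (hV : 2 ≤ Fintype.card V) {G : SimpleGraph A} {d : ℝ} (hd : 0 < d) (hG : ∀ x, d ≤ G.degree x)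
    {S : Set V} (hS : S.Nonempty) {s : ℕ} {c : ℝ} (L : S → A)
    (hL : ∏ l, (G.degree (L l) : ℝ) ≤ c * ∑ X ∈ extensions S L, treeWeight T G X)
    (hc : s * ((Fintype.card V : ℝ) ^ 2 * (c * (d⁻¹) ^ (2 * Fintype.card S - 1))) ≤ 1 / 2) :
    ((∑ X ∈ extensions S L, treeWeight T G X) / 2 * d ^ (Fintype.card V - 2)) ^ s ≤
      #{Y : Fin s → V → A | (∀ i, Y i ∈ extensions S L ∧ treeWeight T G (Y i) ≠ 0) ∧
        ∀ i j, i < j → ¬ Meet S (Y j) (Y i)} := by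
  set μ := ∑ X ∈ extensions S L, treeWeight T G X with hμ
  have hμ0 : 0 ≤ μ := Finset.sum_nonneg fun X _ => treeWeight_nonneg T G X
  set q := ∏ l, (G.degree (L l) : ℝ)
  have hq0 : 0 ≤ q := Finset.prod_nonneg fun _ _ => by positivity
  have hsparse : ∀ X ∈ extensions S L,
      ∑ Y ∈ extensions S L with Meet S X Y, treeWeight T G Y ≤
        (Fintype.card V : ℝ) ^ 2 * (q * (d⁻¹) ^ (2 * Fintype.card S - 1)) := by
    intro X _
    calc _ ≤ ∑ p : V × V with p.1 ∉ S ∧ p.2 ∉ S,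
            ∑ Y ∈ extensions S L with X p.1 = Y p.2, treeWeight T G Y := by
          refine sum_filter_le_sum_sum_filter _ _ (treeWeight_nonneg T G) _ _ ?_
          rintro Y ⟨a, b, ha, hb, hab⟩
          exact ⟨(a, b), by simp [ha, hb], hab⟩
      _ ≤ ∑ p : V × V with p.1 ∉ S ∧ p.2 ∉ S, q * (d⁻¹) ^ (2 * Fintype.card S - 1) := by
          refine Finset.sum_le_sum fun p hp => ?_
          simp only [mem_filter, mem_univ, true_and] at hp
          refine le_trans ?_ (sum_treeWeight_prescribed_on_le hT hd hG hS hp.2 L (X p.1))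
          refine Finset.sum_le_sum_of_subset_of_nonneg ?_ fun _ _ _ => treeWeight_nonneg T G _
          intro Y hY
          simp only [extensions, mem_filter, mem_univ, true_and] at hY ⊢
          exact ⟨hY.1.2, hY.2.symm⟩
      _ ≤ ∑ p : V × V, q * (d⁻¹) ^ (2 * Fintype.card S - 1) :=
          Finset.sum_le_sum_of_subset_of_nonneg (filter_subset _ _) fun _ _ _ => by positivity
      _ = _ := by
          rw [Finset.sum_const, Finset.card_univ, Fintype.card_prod, nsmul_eq_mul]
          push_cast
          ring
  -- Richness of `L` turns the bound in terms of `q` into a small fraction of `μ`, as the greedy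
  -- choice requires.
  have hθ : (s : ℝ) * ((Fintype.card V : ℝ) ^ 2 * (q * (d⁻¹) ^ (2 * Fintype.card S - 1))) ≤
      μ / 2 :=
    calc _ ≤ (s : ℝ) * ((Fintype.card V : ℝ) ^ 2 *
            ((c * μ) * (d⁻¹) ^ (2 * Fintype.card S - 1))) := by gcongr
      _ = s * ((Fintype.card V : ℝ) ^ 2 * (c * (d⁻¹) ^ (2 * Fintype.card S - 1))) * μ := by ring
      _ ≤ 1 / 2 * μ := by gcongr
      _ = _ := by ring
  have H := pow_le_sum_prod_of_sparse_relation (extensions S L) (treeWeight_nonneg T G)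
    (Meet S) hsparse (by positivity) hθ s le_rfl
  rw [mul_pow]
  have hdpos : 0 < d ^ (Fintype.card V - 2) := by positivity
  rw [← le_div_iff₀ (by positivity)]
  refine H.trans ?_
  rw [← Finset.sum_filter_ne_zero]
  -- Since no single map weighs much, a large total weight forces many families.
  refine (Finset.sum_le_card_nsmul _ _ (((d⁻¹) ^ (Fintype.card V - 2)) ^ s) ?_).trans ?_
  · intro Y _
    refine (Finset.prod_le_prod (fun _ _ => treeWeight_nonneg T G _)
      fun i _ => treeWeight_le hT hV hd hG (Y i)).trans ?_
    simp
  · rw [nsmul_eq_mul, inv_pow, inv_pow, ← div_eq_mul_inv]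
    gcongr
    intro Y hY
    simp only [mem_filter, mem_univ, true_and] at hY ⊢
    exact ⟨fun i => ⟨hY.1.1 i, Finset.prod_ne_zero_iff.1 hY.2 i (mem_univ i)⟩, hY.1.2⟩

theorem sum_prod_degree (G : SimpleGraph A) (S : Set V) :
    ∑ L : S → A, ∏ l, (G.degree (L l) : ℝ) = (∑ x, (G.degree x : ℝ)) ^ Fintype.card S := by
  have := (Finset.prod_univ_sum (fun _ : S => (univ : Finset A)) fun _ x => (G.degree x : ℝ)).symm
  simpa [Fintype.piFinset_univ] using this

/-- At least half of the total weight lies on the `L` whose extensions have a fair share of it. -/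
theorem half_le_sum_sum_extensions [Nonempty A] {T : SimpleGraph V} (hT : T.IsTree)
    {G : SimpleGraph A} {d : ℝ} (hG : ∀ x, d ≤ G.degree x)
    {S : Set V} (hS : S.Nonempty) (hd : 4 * (Fintype.card V : ℝ) ^ 2 ≤ d) :
    (∑ x, (G.degree x : ℝ)) / 2 ≤
      ∑ L : S → A with ∏ l, (G.degree (L l) : ℝ) ≤
        4 * (∑ x, (G.degree x : ℝ)) ^ (Fintype.card S - 1) *
          ∑ X ∈ extensions S L, treeWeight T G X,
        ∑ X ∈ extensions S L, treeWeight T G X := by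
  have := hT.connected.nonempty
  have hd0 : 0 < d := lt_of_lt_of_le (by positivity) hd
  have hG' : ∀ x, 0 < G.degree x := fun x => by exact_mod_cast hd0.trans_le (hG x)
  have hr : 0 < Fintype.card S := Fintype.card_pos_iff.2 hS.to_subtype
  set D := ∑ x, (G.degree x : ℝ) with hD
  have hD0 : 0 < D := Finset.sum_pos (fun x _ => by exact_mod_cast hG' x) univ_nonempty
  set μ : (S → A) → ℝ := fun L => ∑ X ∈ extensions S L, treeWeight T G X with hμ
  set q : (S → A) → ℝ := fun L => ∏ l, (G.degree (L l) : ℝ) with hq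
  set c := 4 * D ^ (Fintype.card S - 1) with hcdef
  have hc0 : 0 < c := by positivity
  -- the total weight of injective maps
  have htotal : 3 / 4 * D ≤ ∑ L, μ L := by
    rw [hμ, sum_sum_extensions]
    have h1 := Finset.sum_filter_add_sum_filter_not univ
      (fun X : V → A => Function.Injective X) (treeWeight T G)
    rw [sum_treeWeight hT hG'] at h1
    have h2 := sum_treeWeight_not_injective_le hT hd0 hG
    have h3 : (Fintype.card V : ℝ) ^ 2 * (D * d⁻¹) ≤ D / 4 := by
      rw [← div_eq_mul_inv, mul_div_assoc', div_le_iff₀ hd0]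
      nlinarith
    linarith
  -- On these `L`, `μ L < q L / c`, and the `q L` sum to `D ^ card S`; the 4 in `c` yields `D / 4`.
  have hpoor : ∑ L with ¬ q L ≤ c * μ L, μ L ≤ D / 4 := by
    calc _ ≤ ∑ L with ¬ q L ≤ c * μ L, q L / c := by
          refine Finset.sum_le_sum fun L hL => ?_
          simp only [mem_filter, mem_univ, true_and, not_le] at hL
          rw [le_div_iff₀ hc0]
          linarith
      _ ≤ ∑ L, q L / c := Finset.sum_le_sum_of_subset_of_nonneg (filter_subset _ _)
          fun L _ _ => div_nonneg (Finset.prod_nonneg fun _ _ => by positivity) hc0.le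
      _ = D ^ Fintype.card S / c := by rw [← Finset.sum_div, hq, sum_prod_degree]
      _ = D / 4 := by
          obtain ⟨r, hr'⟩ : ∃ r, Fintype.card S = r + 1 := ⟨_, (Nat.succ_pred_eq_of_pos hr).symm⟩
          rw [hcdef, hr', Nat.add_sub_cancel, pow_succ]
          field_simp
  have := Finset.sum_filter_add_sum_filter_not univ (fun L => q L ≤ c * μ L) μ
  linarith

/-- Supersaturation for glued trees in graphs of large minimum degree. -/
theorem pow_le_labelledCopyCount_glue [Nonempty A] {T : SimpleGraph V} (hT : T.IsTree)
    (hV : 2 ≤ Fintype.card V) {G : SimpleGraph A} {d : ℝ} (hG : ∀ x, d ≤ G.degree x)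
    {S : Set V} (hS : S.Nonempty) {s : ℕ} (hs : 1 ≤ s) (hd : 4 * (Fintype.card V : ℝ) ^ 2 ≤ d)
    (hc : s * ((Fintype.card V : ℝ) ^ 2 * (4 * (∑ x, (G.degree x : ℝ)) ^ (Fintype.card S - 1) *
      (d⁻¹) ^ (2 * Fintype.card S - 1))) ≤ 1 / 2) :
    ((∑ x, (G.degree x : ℝ)) / 4 * d ^ (Fintype.card V - 2)) ^ s ≤
      G.labelledCopyCount (glue T S s) *
        ((Fintype.card A : ℝ) ^ Fintype.card S) ^ (s - 1) := by
  have hd0 : 0 < d := lt_of_lt_of_le (by positivity) hd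
  have hG' : ∀ x, 0 < G.degree x := fun x => by exact_mod_cast hd0.trans_le (hG x)
  have hr : 0 < Fintype.card S := Fintype.card_pos_iff.2 hS.to_subtype
  set D := ∑ x, (G.degree x : ℝ) with hD
  have hD0 : 0 < D := Finset.sum_pos (fun x _ => by exact_mod_cast hG' x) univ_nonempty
  set μ : (S → A) → ℝ := fun L => ∑ X ∈ extensions S L, treeWeight T G X with hμ
  set q : (S → A) → ℝ := fun L => ∏ l, (G.degree (L l) : ℝ) with hq
  set c := 4 * D ^ (Fintype.card S - 1) with hcdef
  have hc0 : 0 < c := by positivity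
  set I := univ.filter fun L => q L ≤ c * μ L with hI
  set N : (S → A) → Finset (Fin s → V → A) := fun L =>
    {Y | (∀ i, Y i ∈ extensions S L ∧ treeWeight T G (Y i) ≠ 0) ∧
        ∀ i j, i < j → ¬ Meet S (Y j) (Y i)} with hN
  have hμ0 : ∀ L, 0 ≤ μ L := fun L => Finset.sum_nonneg fun X _ => treeWeight_nonneg T G X
  have hrich : D / 2 ≤ ∑ L ∈ I, μ L := half_le_sum_sum_extensions hT hG hS hd
  have hfam : ∀ L ∈ I, (μ L / 2 * d ^ (Fintype.card V - 2)) ^ s ≤ (#(N L) : ℝ) := by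
    intro L hL
    simp only [hI, mem_filter, mem_univ, true_and] at hL
    exact pow_le_card_families hT hV hd0 hG hS L hL hc
  have hcount : ∑ L ∈ I, (#(N L) : ℝ) ≤ G.labelledCopyCount (glue T S s) := by
    rw [← Nat.cast_sum, Nat.cast_le]
    apply sum_card_le_labelledCopyCount hs I N <;> intro L Y hY <;>
      simp only [hN, extensions, mem_filter, mem_univ, true_and] at hY
    · exact fun i => (hY.1 i).1.2
    · exact fun i => (hY.1 i).1.1
    · exact fun i u v huv => adj_of_treeWeight_ne_zero (hY.1 i).2 huv
    · exact fun i j hij a b ha hb hab => hY.2 i j hij ⟨a, b, ha, hb, hab⟩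
  have hcardI : (#I : ℝ) ≤ (Fintype.card A : ℝ) ^ Fintype.card S := by
    have : #I ≤ Fintype.card (S → A) := Finset.card_le_univ I
    rw [Fintype.card_fun] at this
    exact_mod_cast this
  refine le_trans ?_ (pow_sum_le_sum_mul I (fun L => mul_nonneg (div_nonneg (hμ0 L) zero_le_two)
    (pow_nonneg hd0.le _)) hs hfam hcount hcardI)
  rw [← Finset.sum_mul, ← Finset.sum_div]
  refine pow_le_pow_left₀ (mul_nonneg (by linarith) (pow_nonneg hd0.le _))
    (mul_le_mul_of_nonneg_right ?_ (pow_nonneg hd0.le _)) s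
  linarith

end Supersaturation


universe u

/-! ### Passing to large minimum degree -/

section Trimming

open scoped Classical

theorem degree_eq_sum_of_adj_iff {A : Type*} [Fintype A] {G : SimpleGraph A} {S : Finset A}
    {H : SimpleGraph S} (hH : ∀ x y, H.Adj x y ↔ G.Adj x y) (x : S) :
    (H.degree x : ℝ) = ∑ y ∈ S, if G.Adj x y then 1 else 0 := by
  rw [← SimpleGraph.card_neighborFinset_eq_degree, SimpleGraph.neighborFinset_eq_filter,
    Finset.card_filter]
  push_cast
  rw [← Finset.sum_coe_sort S]
  simp only [hH]

/-- Every graph has a subgraph of large minimum degree that keeps most edges. -/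
theorem exists_copy_le_degree {A : Type u} [Fintype A] (G : SimpleGraph A) {d : ℝ}
    (hd : 0 ≤ d) :
    ∃ (B : Type u) (_ : Fintype B) (H : SimpleGraph B), Nonempty (H.Copy G) ∧
      (∀ x, d ≤ H.degree x) ∧
      ∑ x, (G.degree x : ℝ) - 2 * d * Fintype.card A ≤ ∑ x, (H.degree x : ℝ) ∧
      ∑ x, (H.degree x : ℝ) ≤ ∑ x, (G.degree x : ℝ) := by
  set e : A → A → ℝ := fun x y => if G.Adj x y then 1 else 0 with he
  have he0 : ∀ x y, 0 ≤ e x y := fun x y => by simp only [he]; split_ifs <;> norm_num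
  have hesymm : ∀ x y, e x y = e y x := fun x y => by simp only [he, G.adj_comm]
  have heself : ∀ x, e x x = 0 := fun x => by simp [he]
  -- At a maximiser, deleting a vertex cannot gain, so every degree is at least `d`; comparison with
  -- the whole vertex set bounds the loss.
  obtain ⟨S, -, hS⟩ := Finset.exists_max_image (univ : Finset (Finset A))
    (fun S => ∑ x ∈ S, ∑ y ∈ S, e x y - 2 * d * #S) univ_nonempty
  obtain ⟨H, hH⟩ : ∃ H : SimpleGraph S, H = G.comap (fun x : S => (x : A)) := ⟨_, rfl⟩
  have hadj : ∀ x y : S, H.Adj x y ↔ G.Adj x y := fun x y => by rw [hH]; rfl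
  have hsum : ∑ x, (H.degree x : ℝ) = ∑ x ∈ S, ∑ y ∈ S, e x y := by
    simp only [degree_eq_sum_of_adj_iff hadj]
    exact Finset.sum_coe_sort S fun x => ∑ y ∈ S, e x y
  have huniv : ∑ x, (G.degree x : ℝ) = ∑ x, ∑ y, e x y := by
    refine Finset.sum_congr rfl fun x _ => ?_
    rw [← SimpleGraph.card_neighborFinset_eq_degree, SimpleGraph.neighborFinset_eq_filter,
      Finset.card_filter]
    push_cast
    rfl
  refine ⟨S, inferInstance, H, ⟨⟨fun x => x, fun h => (hadj _ _).1 h⟩, Subtype.val_injective⟩,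
    fun x => ?_, ?_, ?_⟩
  · rw [degree_eq_sum_of_adj_iff hadj]
    obtain ⟨v, hv⟩ := x
    have hv' : v ∈ S := hv
    have h1 := hS (S.erase v) (mem_univ _)
    have h2 : ∑ x ∈ S, ∑ y ∈ S, e x y =
        ∑ x ∈ S.erase v, ∑ y ∈ S.erase v, e x y + 2 * ∑ y ∈ S, e v y := by
      rw [← Finset.add_sum_erase S _ hv']
      have h3 : ∀ x ∈ S.erase v, ∑ y ∈ S, e x y = e v x + ∑ y ∈ S.erase v, e x y :=
        fun x _ => by rw [← Finset.add_sum_erase S _ hv', hesymm]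
      rw [Finset.sum_congr rfl h3, Finset.sum_add_distrib]
      have h4 : ∑ y ∈ S, e v y = ∑ y ∈ S.erase v, e v y := by
        rw [← Finset.add_sum_erase S _ hv', heself, zero_add]
      rw [h4]
      ring
    have h5 : (#(S.erase v) : ℝ) = #S - 1 := by
      rw [Finset.card_erase_of_mem hv', Nat.cast_sub (Finset.card_pos.2 ⟨v, hv'⟩), Nat.cast_one]
    rw [h2, h5] at h1
    change d ≤ ∑ y ∈ S, e v y
    linarith
  · rw [hsum, huniv]
    have h1 := hS univ (mem_univ _)
    rw [Finset.card_univ] at h1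
    have : 0 ≤ 2 * d * #S := by positivity
    linarith
  · rw [hsum, huniv]
    calc _ ≤ ∑ x ∈ S, ∑ y, e x y := Finset.sum_le_sum fun x _ =>
          Finset.sum_le_sum_of_subset_of_nonneg (subset_univ _) fun _ _ _ => he0 _ _
      _ ≤ _ := Finset.sum_le_sum_of_subset_of_nonneg (subset_univ _)
          fun _ _ _ => Finset.sum_nonneg fun _ _ => he0 _ _

end Trimming

/-! ### Labelled and unlabelled copies -/

section CopyCount

open scoped Classical

theorem labelledCopyCount_eq_natCard {W A : Type*} [Fintype W] [Fintype A] (G : SimpleGraph A)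
    (H : SimpleGraph W) : G.labelledCopyCount H = Nat.card (H.Copy G) := by
  rw [SimpleGraph.labelledCopyCount, Nat.card_eq_fintype_card]

theorem labelledCopyCount_le_of_copy {W A B : Type*} [Fintype W] [Fintype A] [Fintype B]
    {G : SimpleGraph A} {G' : SimpleGraph B} (c : G'.Copy G) (H : SimpleGraph W) :
    G'.labelledCopyCount H ≤ G.labelledCopyCount H := by
  have hinj : Function.Injective fun f : H.Copy G' => c.comp f := by
    intro f g hfg
    ext x
    exact c.injective (DFunLike.congr_fun hfg x)
  rw [labelledCopyCount_eq_natCard, labelledCopyCount_eq_natCard]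
  exact Nat.card_le_card_of_injective _ hinj

/-- Labelled copies with the same image subgraph are maps into one set of `card W` vertices. -/
theorem labelledCopyCount_le_mul_copyCount {W A : Type*} [Fintype W] [Fintype A]
    (G : SimpleGraph A) (H : SimpleGraph W) :
    G.labelledCopyCount H ≤ Fintype.card W ^ Fintype.card W * G.copyCount H := by
  rw [SimpleGraph.copyCount_eq_card_image_copyToSubgraph]
  rw [labelledCopyCount_eq_natCard, Nat.card_eq_fintype_card, ← Finset.card_univ]
  refine Finset.card_le_mul_card_image _ _ fun G' hG' => ?_
  obtain ⟨f, -, rfl⟩ := Finset.mem_image.1 hG'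
  calc _ ≤ #(Fintype.piFinset fun _ : W => univ.image f) := by
        refine Finset.card_le_card_of_injOn (fun g => (g : W → A)) ?_ ?_
        · intro g hg
          simp only [coe_filter, mem_univ, true_and, Set.mem_ofPred_eq] at hg
          simp only [Finset.mem_coe, Fintype.mem_piFinset, mem_image, mem_univ, true_and]
          intro x
          have h1 : g x ∈ g.toSubgraph.verts := by simp [SimpleGraph.Copy.toSubgraph]
          rw [hg] at h1
          simpa [SimpleGraph.Copy.toSubgraph] using h1
        · intro g _ g' _ h
          exact DFunLike.coe_injective h
    _ = Fintype.card W ^ Fintype.card W := by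
        rw [Fintype.card_piFinset, Finset.prod_const,
          Finset.card_image_of_injective univ (f := f) f.injective, Finset.card_univ]

end CopyCount

/-! ### Parameters of the glued graph -/

section GlueProperties

variable {V : Type*} {T : SimpleGraph V} {S : Set V} {s : ℕ}

/-- The projection of the glued graph to the graph. -/
def glueProj (T : SimpleGraph V) (S : Set V) (s : ℕ) : glue T S s →g T where
  toFun := Sum.elim (fun l => l) fun p => p.1
  map_rel' := by
    have hval : ∀ i v, Sum.elim (fun l : S => (l : V)) (fun p : ↥Sᶜ × Fin s => (p.1 : V))
        (glueEmb S s i v) = v := by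
      intro i v
      by_cases hv : v ∈ S
      · rw [glueEmb_of_mem i hv, Sum.elim_inl]
      · rw [glueEmb_of_notMem i hv, Sum.elim_inr]
    intro x y hxy
    simp only [glue, SimpleGraph.iSup_adj, SimpleGraph.map_adj] at hxy
    obtain ⟨i, u, v, huv, rfl, rfl⟩ := hxy
    rwa [hval, hval]

theorem isBipartite_glue (hT : T.IsTree) : (glue T S s).IsBipartite :=
  hT.isBipartite.of_hom (glueProj T S s)

/-- An end outside `S` records which copy an edge comes from. A lower bound suffices, since `p ≤ 1`
makes extra edges only weaken the target. -/
theorem mul_ncard_edgeSet_le_ncard_edgeSet_glue [Finite V]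
    (hS : ∀ u v, T.Adj u v → u ∉ S ∨ v ∉ S) :
    T.edgeSet.ncard * s ≤ (glue T S s).edgeSet.ncard := by
  have hmem : ∀ p : T.edgeSet × Fin s,
      Sym2.map (glueEmb S s p.2) p.1 ∈ (glue T S s).edgeSet := by
    rintro ⟨⟨e, he⟩, i⟩
    induction e using Sym2.ind with
    | _ u v =>
      simp only [Sym2.map_mk, SimpleGraph.mem_edgeSet, glue, SimpleGraph.iSup_adj,
        SimpleGraph.map_adj]
      exact ⟨i, u, v, he, rfl, rfl⟩
  have hinj : Function.Injective fun p : T.edgeSet × Fin s =>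
      (⟨Sym2.map (glueEmb S s p.2) p.1, hmem p⟩ : (glue T S s).edgeSet) := by
    rintro ⟨⟨e, he⟩, i⟩ ⟨⟨e', he'⟩, j⟩ h
    simp only [Subtype.mk.injEq] at h
    obtain ⟨v, hv, hvS⟩ : ∃ v ∈ e, v ∉ S := by
      induction e using Sym2.ind with
      | _ u v =>
        rcases hS u v he with h | h
        · exact ⟨u, by simp, h⟩
        · exact ⟨v, by simp, h⟩
    have h1 : glueEmb S s i v ∈ Sym2.map (glueEmb S s j) e' := by
      rw [← h]
      exact Sym2.mem_map.2 ⟨v, hv, rfl⟩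
    obtain ⟨w, -, hw⟩ := Sym2.mem_map.1 h1
    have hij : j = i := by
      rw [glueEmb_of_notMem i hvS] at hw
      by_cases hwS : w ∈ S
      · rw [glueEmb_of_mem j hwS] at hw
        exact absurd hw (by simp)
      · rw [glueEmb_of_notMem j hwS] at hw
        simpa using (Prod.mk.inj (Sum.inr.inj hw)).2
    subst hij
    have := Sym2.map.injective (glueEmb S s j).injective h
    subst this
    rfl
  have := Nat.card_le_card_of_injective _ hinj
  rwa [Nat.card_prod, Nat.card_fin, Nat.card_coe_set_eq, Nat.card_coe_set_eq] at this

theorem card_glueVertex [Finite V] :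
    Nat.card (GlueVertex S s) = S.ncard + (Nat.card V - S.ncard) * s := by
  rw [Nat.card_sum, Nat.card_prod, Nat.card_fin, Nat.card_coe_set_eq, Nat.card_coe_set_eq,
    Set.ncard_compl]

end GlueProperties

/-! ### Leaves of a tree -/

section Leaves

variable {V : Type*} [Fintype V] {T : SimpleGraph V}

theorem leaves_nonempty (hT : T.IsTree) (hV : 2 ≤ Fintype.card V) : (leaves T).Nonempty := by
  classical
  have : Nontrivial V := Fintype.one_lt_card_iff_nontrivial.1 hV
  obtain ⟨v, hv⟩ := hT.exists_vert_degree_one_of_nontrivial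
  refine ⟨v, ?_⟩
  rw [leaves, Set.mem_ofPred_eq, Set.ncard_eq_toFinset_card', ← hv]
  rfl

theorem eq_of_adj_leaf {V : Type*} {T : SimpleGraph V} {u v w : V}
    (hu : u ∈ leaves T) (hv : T.Adj u v) (hw : T.Adj u w) :
    v = w := by
  obtain ⟨x, hx⟩ := Set.ncard_eq_one.1 hu
  have h1 : v ∈ T.neighborSet u := hv
  have h2 : w ∈ T.neighborSet u := hw
  rw [hx] at h1 h2
  exact h1.trans h2.symm

/-- Two adjacent leaves would make up a whole component, hence the whole tree. -/
theorem notMem_leaves_or_of_adj (hT : T.IsTree) (hV : 3 ≤ Fintype.card V) (u v : V)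
    (huv : T.Adj u v) : u ∉ leaves T ∨ v ∉ leaves T := by
  classical
  by_contra! h
  have hall : ∀ k w, T.dist u w = k → w = u ∨ w = v := by
    intro k
    induction k using Nat.strong_induction_on with
    | _ k ih =>
      intro w hw
      by_cases hwu : w = u
      · exact Or.inl hwu
      · obtain ⟨x, hxw, hlt⟩ := exists_adj_dist_lt hT.connected hwu
        rcases ih _ (hw ▸ hlt) x rfl with rfl | rfl
        · exact Or.inr (eq_of_adj_leaf h.1 hxw huv)
        · exact Or.inl (eq_of_adj_leaf h.2 hxw huv.symm)
  have hsub : (univ : Finset V) ⊆ {u, v} := fun w _ => by simpa using hall _ w rfl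
  have h1 := Finset.card_le_card hsub
  have h2 := Finset.card_le_two (a := u) (b := v)
  rw [Finset.card_univ] at h1
  omega

theorem exists_notMem_leaves (hT : T.IsTree) (hV : 3 ≤ Fintype.card V) : ∃ c, c ∉ leaves T := by
  have : Nontrivial V := Fintype.one_lt_card_iff_nontrivial.1 (by omega)
  obtain ⟨u⟩ := hT.connected.nonempty
  obtain ⟨v, huv⟩ := hT.connected.preconnected.exists_adj_of_nontrivial u
  rcases notMem_leaves_or_of_adj hT hV u v huv with h | h
  exacts [⟨u, h⟩, ⟨v, h⟩]

theorem ncard_edgeSet_add_one (hT : T.IsTree) : T.edgeSet.ncard + 1 = Fintype.card V := by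
  classical
  rw [← hT.card_edgeFinset, Set.ncard_eq_toFinset_card']
  rfl

theorem ncard_leaves_le (hT : T.IsTree) (hV : 3 ≤ Fintype.card V) :
    (leaves T).ncard ≤ T.edgeSet.ncard := by
  obtain ⟨c, hc⟩ := exists_notMem_leaves hT hV
  have h1 : (leaves T).ncard < (Set.univ : Set V).ncard :=
    Set.ncard_lt_ncard (Set.ssubset_univ_iff.2 fun h => hc (h ▸ Set.mem_univ c))
  rw [Set.ncard_univ, Nat.card_eq_fintype_card, ← ncard_edgeSet_add_one hT] at h1
  omega

/-- Equality leaves a single non-leaf; every leaf has a non-leaf neighbour, so the tree is a star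
centred there. -/
theorem ncard_leaves_lt (hT : T.IsTree) (hV : 3 ≤ Fintype.card V)
    (hstar : ¬ ∃ c, ∀ v, v ≠ c → T.Adj c v) : (leaves T).ncard < T.edgeSet.ncard := by
  refine lt_of_le_of_ne (ncard_leaves_le hT hV) fun h => hstar ?_
  have : Nontrivial V := Fintype.one_lt_card_iff_nontrivial.1 (by omega)
  have h1 : (leaves T)ᶜ.ncard = 1 := by
    have h2 := ncard_edgeSet_add_one hT
    rw [Set.ncard_compl, Nat.card_eq_fintype_card]
    omega
  obtain ⟨c, hc⟩ := Set.ncard_eq_one.1 h1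
  have hmem : ∀ v, v ∉ leaves T → v = c := fun v hv => by
    have : v ∈ (leaves T)ᶜ := hv
    rwa [hc] at this
  refine ⟨c, fun v hvc => ?_⟩
  obtain ⟨u, hvu⟩ := hT.connected.preconnected.exists_adj_of_nontrivial v
  rcases notMem_leaves_or_of_adj hT hV v u hvu with h | h
  · exact absurd (hmem v h) hvc
  · rw [← hmem u h]
    exact hvu.symm

end Leaves


/-! ### Constants and conclusion -/

/-- With y = n^(-1/r) the hypothesis reads p ≥ C y, where y^r = 1/n and y ≥ 1/n. The first bound
makes the minimum degree large, the second makes conflicts between extensions rare. -/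
theorem density_bounds {n r : ℕ} (hn : 1 ≤ n) (hr : 1 ≤ r) {C p : ℝ} (hC : 1 ≤ C)
    (h : C * (n : ℝ) ^ (1 + (1 - 1 / (r : ℝ))) ≤ p * (n : ℝ) ^ 2) :
    C ≤ p * n ∧ C ≤ n * p ^ r := by
  have hn0 : (0 : ℝ) < n := by exact_mod_cast hn
  have hr0 : (r : ℝ) ≠ 0 := by positivity
  obtain ⟨y, hy⟩ : ∃ y, y = (n : ℝ) ^ (-(1 / (r : ℝ))) := ⟨_, rfl⟩
  have hy0 : 0 < y := hy ▸ Real.rpow_pos_of_pos hn0 _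
  have hyr : y ^ r = (n : ℝ)⁻¹ := by
    rw [hy, ← Real.rpow_natCast, ← Real.rpow_mul hn0.le, neg_mul, one_div, inv_mul_cancel₀ hr0,
      Real.rpow_neg_one]
  have hy1 : y ≤ 1 := hy ▸ Real.rpow_le_one_of_one_le_of_nonpos (by exact_mod_cast hn)
    (neg_nonpos.2 (by positivity))
  have hyn : (n : ℝ)⁻¹ ≤ y := hyr ▸ pow_le_of_le_one hy0.le hy1 (by omega)
  have hp : C * y ≤ p := by
    rw [show 1 + (1 - 1 / (r : ℝ)) = 2 + -(1 / (r : ℝ)) by ring, Real.rpow_add hn0, ← hy,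
      Real.rpow_two] at h
    refine le_of_mul_le_mul_right ?_ (by positivity : (0 : ℝ) < n ^ 2)
    linarith
  have hC0 : 0 < C := by linarith
  constructor
  · calc C = C * (n : ℝ)⁻¹ * n := by field_simp
      _ ≤ C * y * n := by gcongr
      _ ≤ p * n := by gcongr
  · calc C ≤ C ^ r := le_self_pow₀ hC (by omega)
      _ = n * (C * y) ^ r := by rw [mul_pow, hyr]; field_simp
      _ ≤ n * p ^ r := by gcongr

theorem codegree_bound {r s t : ℕ} (hr : 1 ≤ r) {n p D : ℝ} (hn : 0 < n) (hp : 0 < p)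
    (hD0 : 0 ≤ D) (hD : D ≤ 2 * p * n ^ 2) (h : 16 * 8 ^ r * s * (t : ℝ) ^ 2 ≤ n * p ^ r) :
    s * ((t : ℝ) ^ 2 * (4 * D ^ (r - 1) * ((p * n / 2)⁻¹) ^ (2 * r - 1))) ≤ 1 / 2 := by
  obtain ⟨k, rfl⟩ : ∃ k, r = k + 1 := ⟨_, (Nat.succ_pred_eq_of_pos hr).symm⟩
  rw [Nat.add_sub_cancel, show 2 * (k + 1) - 1 = 2 * k + 1 by omega]
  calc _ ≤ s * ((t : ℝ) ^ 2 * (4 * (2 * p * n ^ 2) ^ k * ((p * n / 2)⁻¹) ^ (2 * k + 1))) := by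
        gcongr
    _ = s * (t : ℝ) ^ 2 * 8 * 8 ^ k / (n * p ^ (k + 1)) := by
        have : (2 * p * n ^ 2) ^ k * ((p * n / 2)⁻¹) ^ (2 * k + 1) =
            2 * 8 ^ k / (n * p ^ (k + 1)) := by
          have h1 : (2 * p * n ^ 2) * ((p * n / 2)⁻¹) ^ 2 = 8 / p := by
            field_simp
            norm_num
          have h2 : ∀ a b : ℝ, a ^ k * b ^ (2 * k + 1) = (a * b ^ 2) ^ k * b := fun a b => by ring
          rw [h2, h1, div_pow, pow_succ p]
          field_simp
        rw [mul_assoc 4, this]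
        ring
    _ ≤ 1 / 2 := by
        rw [div_le_iff₀ (by positivity)]
        rw [pow_succ (8 : ℝ)] at h
        have : 0 ≤ (8 : ℝ) ^ k * s * (t : ℝ) ^ 2 := by positivity
        nlinarith

open scoped Classical in
/-- Supersaturation for glued trees in dense enough graphs, counting labelled copies. -/
theorem pow_le_labelledCopyCount_glue_of_density {V : Type*} [Fintype V] {T : SimpleGraph V}
    (hT : T.IsTree) (hV : 2 ≤ Fintype.card V) {S : Set V} (hS : S.Nonempty) {s : ℕ} (hs : 1 ≤ s)
    {n : ℕ} (hn : 0 < n) (G : SimpleGraph (Fin n)) {p : ℝ} (hp : 0 < p)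
    (hG : ∑ x, (G.degree x : ℝ) = 2 * p * (n : ℝ) ^ 2)
    (hd : 8 * (Fintype.card V : ℝ) ^ 2 ≤ p * n)
    (hc : 16 * 8 ^ S.ncard * s * (Fintype.card V : ℝ) ^ 2 ≤ n * p ^ S.ncard) :
    (p * (n : ℝ) ^ 2 / 4 * (p * n / 2) ^ (Fintype.card V - 2)) ^ s ≤
      (G.labelledCopyCount (glue T S s) : ℝ) * ((n : ℝ) ^ S.ncard) ^ (s - 1) := by
  have hcardS : Fintype.card S = S.ncard := by
    rw [← Nat.card_eq_fintype_card, Nat.card_coe_set_eq]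
  have hn0 : (0 : ℝ) < n := by exact_mod_cast hn
  -- Trimming at `p * n / 2` loses at most `p * n ^ 2`, half of the degree sum.
  obtain ⟨B, _, H, ⟨c⟩, hdeg, hlow, hupp⟩ :=
    exists_copy_le_degree G (d := p * n / 2) (by positivity)
  rw [hG, Fintype.card_fin] at hlow
  rw [hG] at hupp
  have hpn : 0 < p * (n : ℝ) ^ 2 := by positivity
  have hD : p * (n : ℝ) ^ 2 ≤ ∑ x, (H.degree x : ℝ) := by linarith
  have hne : Nonempty B := by
    by_contra hempty
    rw [not_nonempty_iff] at hempty
    rw [Finset.univ_eq_empty, Finset.sum_empty] at hD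
    linarith
  have hcount := pow_le_labelledCopyCount_glue hT hV hdeg hS hs (by linarith)
    (by
      rw [hcardS]
      exact codegree_bound ((Set.ncard_pos).2 hS) hn0 hp (hpn.le.trans hD) hupp hc)
  rw [hcardS] at hcount
  have hB : (Fintype.card B : ℝ) ≤ n := by
    have := Fintype.card_le_of_injective c c.injective
    rw [Fintype.card_fin] at this
    exact_mod_cast this
  have hlab : (H.labelledCopyCount (glue T S s) : ℝ) ≤ G.labelledCopyCount (glue T S s) := by
    exact_mod_cast labelledCopyCount_le_of_copy c (glue T S s)
  refine le_trans ?_ (hcount.trans ?_)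
  · exact pow_le_pow_left₀ (by positivity) (mul_le_mul_of_nonneg_right (by linarith)
      (by positivity)) s
  · exact mul_le_mul hlab (pow_le_pow_left₀ (pow_nonneg (Nat.cast_nonneg _) _)
      (pow_le_pow_left₀ (Nat.cast_nonneg _) hB _) _)
      (pow_nonneg (pow_nonneg (Nat.cast_nonneg _) _) _) (Nat.cast_nonneg _)

/-- Solving the supersaturation inequality for the number of copies. -/
theorem le_of_pow_le_mul {r s t w E : ℕ} (ht : 2 ≤ t) (hrt : r ≤ t) (hs : 1 ≤ s)
    (hw : w = r + (t - r) * s) (hE : (t - 1) * s ≤ E) {n p K N : ℝ} (hn : 0 < n) (hp : 0 < p)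
    (hp1 : p ≤ 1) (hK : 0 < K)
    (h : (p * n ^ 2 / 4 * (p * n / 2) ^ (t - 2)) ^ s ≤ K * N * (n ^ r) ^ (s - 1)) :
    ((2 : ℝ) ^ t)⁻¹ ^ s / K * p ^ E * n ^ w ≤ N := by
  have hpow : p * n ^ 2 / 4 * (p * n / 2) ^ (t - 2) = (2 ^ t)⁻¹ * p ^ (t - 1) * n ^ t := by
    obtain ⟨m, rfl⟩ : ∃ m, t = m + 2 := ⟨t - 2, by omega⟩
    rw [Nat.add_sub_cancel, show m + 2 - 1 = m + 1 by omega, div_pow, mul_pow]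
    field_simp
    ring
  -- The power of `n` lost to the power mean inequality is exactly what the identification of the
  -- glued vertices saves.
  have hexp : w + r * (s - 1) = t * s := by
    obtain ⟨m, rfl⟩ : ∃ m, t = r + m := ⟨t - r, by omega⟩
    obtain ⟨k, rfl⟩ : ∃ k, s = k + 1 := ⟨s - 1, by omega⟩
    rw [hw, Nat.add_sub_cancel_left, Nat.add_sub_cancel]
    ring
  refine le_of_mul_le_mul_right ?_ (by positivity : 0 < K * (n ^ r) ^ (s - 1))
  calc _ ≤ ((2 : ℝ) ^ t)⁻¹ ^ s / K * p ^ ((t - 1) * s) * n ^ w * (K * (n ^ r) ^ (s - 1)) := by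
        gcongr ?_ * _ * _
        exact mul_le_mul_of_nonneg_left (pow_le_pow_of_le_one hp.le hp1 hE) (by positivity)
    _ = ((2 : ℝ) ^ t)⁻¹ ^ s * p ^ ((t - 1) * s) * (n ^ w * n ^ (r * (s - 1))) := by
        rw [← pow_mul]
        field_simp
    _ = (p * n ^ 2 / 4 * (p * n / 2) ^ (t - 2)) ^ s := by
        rw [← pow_add, hexp, hpow, mul_pow, mul_pow, ← pow_mul, ← pow_mul]
    _ ≤ _ := h
    _ = _ := by ring

open scoped Classical in
theorem sum_degree_le_sq {n : ℕ} (G : SimpleGraph (Fin n)) :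
    ∑ x, (G.degree x : ℝ) ≤ (n : ℝ) ^ 2 := by
  calc _ ≤ ∑ _x : Fin n, (n : ℝ) := Finset.sum_le_sum fun x _ => by
        have := (G.degree_lt_card_verts x).le
        rw [Fintype.card_fin] at this
        exact_mod_cast this
    _ = _ := by
        rw [Finset.sum_const, Finset.card_univ, Fintype.card_fin, nsmul_eq_mul, sq]

open scoped Classical in
/-- Gluing `s` copies of a tree along an independent set of `r` vertices gives a
`1 - 1 / r`-good graph. -/
theorem exists_isGood_glue {V : Type*} [Fintype V] {T : SimpleGraph V} (hT : T.IsTree)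
    (hV : 2 ≤ Fintype.card V) {S : Set V} (hS : S.Nonempty)
    (hindep : ∀ u v, T.Adj u v → u ∉ S ∨ v ∉ S) {s : ℕ} (hs : 1 ≤ s) :
    ∃ C β : ℝ, 0 < C ∧ 0 < β ∧ IsGood (glue T S s) (1 - 1 / (S.ncard : ℝ)) C β := by
  have hr : 1 ≤ S.ncard := (Set.ncard_pos).2 hS
  have hrt : S.ncard ≤ Fintype.card V := by
    rw [← Nat.card_eq_fintype_card, ← Set.ncard_univ]
    exact Set.ncard_le_ncard (Set.subset_univ S)
  have hW := card_glueVertex (S := S) (s := s)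
  have hE := mul_ncard_edgeSet_le_ncard_edgeSet_glue (s := s) hindep
  have hET := ncard_edgeSet_add_one hT
  rw [show T.edgeSet.ncard = Fintype.card V - 1 by omega] at hE
  rw [Nat.card_eq_fintype_card (α := V)] at hW
  have hw : 0 < Nat.card (GlueVertex S s) := by rw [hW]; omega
  have hcopies : ∀ (n : ℕ) (G : SimpleGraph (Fin n)), (G.labelledCopyCount (glue T S s) : ℝ) ≤
      (Nat.card (GlueVertex S s) : ℝ) ^ Nat.card (GlueVertex S s) *
        G.copyCount (glue T S s) := fun n G => by
    rw [Nat.card_eq_fintype_card]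
    exact_mod_cast labelledCopyCount_le_mul_copyCount G (glue T S s)
  have hs' : (1 : ℝ) ≤ s := by exact_mod_cast hs
  have ht' : (1 : ℝ) ≤ (Fintype.card V : ℝ) ^ 2 :=
    one_le_pow₀ (by exact_mod_cast (by omega : 1 ≤ Fintype.card V))
  have h8 : (1 : ℝ) ≤ 8 ^ S.ncard := one_le_pow₀ (by norm_num)
  have hCt : 8 * (Fintype.card V : ℝ) ^ 2 ≤
      16 * 8 ^ S.ncard * s * (Fintype.card V : ℝ) ^ 2 :=
    mul_le_mul_of_nonneg_right (by nlinarith) (by positivity)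
  have hK : (0 : ℝ) < (Nat.card (GlueVertex S s) : ℝ) ^ Nat.card (GlueVertex S s) := by
    positivity
  -- `C` meets both the minimum degree and the conflict condition; the denominator of `β` pays for
  -- passing from labelled to unlabelled copies.
  refine ⟨16 * 8 ^ S.ncard * s * (Fintype.card V : ℝ) ^ 2,
    ((2 : ℝ) ^ Fintype.card V)⁻¹ ^ s /
      (Nat.card (GlueVertex S s) : ℝ) ^ Nat.card (GlueVertex S s),
    by positivity, by positivity, isBipartite_glue hT, fun n G p he hpn => ?_⟩
  rcases Nat.eq_zero_or_pos n with rfl | hn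
  · rw [Nat.cast_zero, zero_pow hw.ne', mul_zero]
    exact Nat.cast_nonneg _
  have hn0 : (0 : ℝ) < n := by exact_mod_cast hn
  obtain ⟨h1, h2⟩ := density_bounds hn hr (by linarith) hpn
  have hp0 : 0 < p := pos_of_mul_pos_left (lt_of_lt_of_le (by linarith) h1) hn0.le
  have hsum : ∑ x, (G.degree x : ℝ) = 2 * p * (n : ℝ) ^ 2 := by
    rw [mul_assoc, ← he, Set.ncard_eq_toFinset_card']
    exact_mod_cast G.sum_degrees_eq_twice_card_edges
  have hp1 : p ≤ 1 := by
    have hle := sum_degree_le_sq G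
    rw [hsum] at hle
    have := le_of_mul_le_mul_right (hle.trans_eq (one_mul _).symm)
      (by positivity : (0 : ℝ) < (n : ℝ) ^ 2)
    linarith
  refine le_of_pow_le_mul hV hrt hs hW hE hn0 hp0 hp1 hK ?_
  exact (pow_le_labelledCopyCount_glue_of_density hT hV hS hs hn G hp0 hsum (hCt.trans h1)
    h2).trans (mul_le_mul_of_nonneg_right (hcopies n G) (by positivity))

end ErdosSimonovits

theorem corollary1p9 {V : Type*} [Fintype V] (T : SimpleGraph V) (hT : T.IsTree)
    (ht : 3 ≤ Fintype.card V) (s : ℕ) (hs : 1 ≤ s) :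
    (∃ C β : ℝ, 0 < C ∧ 0 < β ∧
      ErdosSimonovits.IsGood (ErdosSimonovits.glue T (ErdosSimonovits.leaves T) s)
        (1 - 1 / ((ErdosSimonovits.leaves T).ncard : ℝ)) C β) ∧
    (1 - 1 / ((ErdosSimonovits.leaves T).ncard : ℝ) ≤ 1 - 1 / (T.edgeSet.ncard : ℝ)) ∧
    ((¬ ∃ c : V, ∀ v : V, v ≠ c → T.Adj c v) →
      1 - 1 / ((ErdosSimonovits.leaves T).ncard : ℝ) < 1 - 1 / (T.edgeSet.ncard : ℝ)) := by
  have hne := ErdosSimonovits.leaves_nonempty hT (by omega)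
  have hpos : (0 : ℝ) < (ErdosSimonovits.leaves T).ncard := by
    exact_mod_cast (Set.ncard_pos).2 hne
  refine ⟨ErdosSimonovits.exists_isGood_glue hT (by omega) hne
    (ErdosSimonovits.notMem_leaves_or_of_adj hT ht) hs, ?_, fun hstar => ?_⟩
  · have h : ((ErdosSimonovits.leaves T).ncard : ℝ) ≤ T.edgeSet.ncard := by
      exact_mod_cast ErdosSimonovits.ncard_leaves_le hT ht
    exact sub_le_sub_left (one_div_le_one_div_of_le hpos h) 1
  · have h : ((ErdosSimonovits.leaves T).ncard : ℝ) < T.edgeSet.ncard := by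
      exact_mod_cast ErdosSimonovits.ncard_leaves_lt hT ht hstar
    exact sub_lt_sub_left (one_div_lt_one_div_of_lt hpos h) 1
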